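/- Let $(\overline M^{2n+1},\overline\phi,\xi,\eta,\overline g)$ be an indefinite nearly $\mu$-Sasakian manifold: $\overline g$ is a semi-Riemannian metric with Levi-Civita connection $\overline\nabla$, $\overline\phi^2=-I+\eta\otimes\xi$, $\eta(\xi)=1$, $\eta\circ\overline\phi=0$, $\overline\phi\xi=0$, $\overline g(\overline\phi\,\cdot,\overline\phi\,\cdot)=\overline g-\eta\otimes\eta$, $\eta=\overline g(\xi,\cdot)$, and $$(\overline\nabla_{X}\overline\phi)Y+(\overline\nabla_{Y}\overline\phi)X=\mu\{2\overline g(X,Y)\xi-\eta(Y)X-\eta(X)Y\}$$ for all vector fields $X,Y$ on $\overline M$, where $\mu$ is a real function on $\overline M$ (for instance a constant). Let $(M,g,S(TM),S(TM^\perp))$ be an (immersed) $r$-lightlike submanifold of $\overline M$, $r>0$: $\mathrm{Rad}\,TM=TM\cap TM^\perp$ has constant rank $r$, $TM=\mathrm{Rad}\,TM\perp S(TM)$ and $TM^\perp=\mathrm{Rad}\,TM\perp S(TM^\perp)$ with $S(TM)$, $S(TM^\perp)$ nondegenerate. Let $l\mathrm{tr}(TM)$ be a totally null complement of $\mathrm{Rad}\,TM$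 in the orthogonal complement of $S(TM)\perp S(TM^\perp)$, and $\mathrm{tr}(TM)=l\mathrm{tr}(TM)\perp S(TM^\perp)$, so that $T\overline M|_M=TM\oplus\mathrm{tr}(TM)$. For $X,Y\in\Gamma(TM)$ and $V\in\Gamma(\mathrm{tr}(TM))$ write, with respect to this decomposition, $$\overline\nabla_XY=\nabla_XY+h(X,Y),\qquad \overline\nabla_XV=-A_VX+\nabla^t_XV,\qquad \overline\phi X=\phi_1X+\varphi_1X .$$ Assume that $M$ is QGCR-lightlike: there are vector subbundles $D_1,D_2\subset\mathrm{Rad}\,TM$, $D_0,\overline D\subset S(TM)$, $\mathcal L\subset l\mathrm{tr}(TM)$, $\mathcal S\subset S(TM^\perp)$ with $\mathrm{Rad}\,TM=D_1\oplus D_2$, $\overline\phi D_1=D_1$, $\overline\phi D_2\subset S(TM)$, $S(TM)=\{\overline\phi D_2\oplus\overline D\}\perp D_0$, $\overline\phi D_0\subseteq D_0$, $\overline D=\overline\phi\mathcal S\oplus\overline\phi\mathcal L$, and $D_0$ nondegenerate. Assume moreover that $M$ is co-screen, that is, $\xi\in\Gamma(S(TM^\perp))$ along $M$. Put $D=\mathrm{Rad}\,TM\perp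 D_0\perp\overline\phi D_2$, so that $TM=D\oplus\overline D$. (i) If $\overline D$ is nearly parallel, i.e. $\nabla_XY+\nabla_YX\in\Gamma(\overline D)$ for all $X\in\Gamma(TM)$ and $Y\in\Gamma(\overline D)$, then $$-A_{\varphi_1X}Y-A_{\overline\phi Y}X+\nabla_Y\phi_1X$$ has no component in $D$ (with respect to $TM=D\oplus\overline D$), for all $Y\in\Gamma(\overline D)$ and $X\in\Gamma(TM)$. (ii) Suppose that the transversal bundle decomposes as $\mathrm{tr}(TM)=\overline\phi\,\overline D\perp\mathcal G\perp\mathbb R\xi$ with $\overline\phi\mathcal G=\mathcal G$. Then, for all $X\in\Gamma(TM)$, $Y\in\Gamma(\overline D)$ and every point $p\in M$ at which $(\nabla_XY+\nabla_YX)_p\in\overline D_p$, the vector in (i) has no component in $D$ at $p$. -/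

import Mathlib

open scoped Manifold ContDiff Topology
open Bundle

noncomputable section

/-! ### Semi-Riemannian ambient manifolds -/

section Ambient

variable {d : ℕ} {N : Type*} [TopologicalSpace N] [ChartedSpace (EuclideanSpace ℝ (Fin d)) N]
  [IsManifold (𝓡 d) ∞ N]

/-- The vector field `X` is smooth at the point `x`. -/
def SmoothFieldAt (X : Π x : N, TangentSpace (𝓡 d) x) (x : N) : Prop :=
  ContMDiffAt (𝓡 d) (𝓡 d).tangent ∞ (fun y => (⟨y, X y⟩ : TangentBundle (𝓡 d) N)) x

/-- The vector field `X` is smooth: `X ∈ Γ(TN)`. -/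
def SmoothField (X : Π x : N, TangentSpace (𝓡 d) x) : Prop := ∀ x, SmoothFieldAt X x

/-- A semi-Riemannian metric: a smooth symmetric nondegenerate `(0,2)`-tensor field of constant
index. -/
structure SemiRiemannianMetric (d : ℕ) (N : Type*) [TopologicalSpace N]
    [ChartedSpace (EuclideanSpace ℝ (Fin d)) N] [IsManifold (𝓡 d) ∞ N] where
  val : Π x : N, TangentSpace (𝓡 d) x →L[ℝ] TangentSpace (𝓡 d) x →L[ℝ] ℝ
  symm : ∀ (x : N) (u v : TangentSpace (𝓡 d) x), val x u v = val x v u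
  nondegenerate : ∀ (x : N) (u : TangentSpace (𝓡 d) x), (∀ v, val x u v = 0) → u = 0
  smooth : ContMDiff (𝓡 d)
    ((𝓡 d).prod 𝓘(ℝ, EuclideanSpace ℝ (Fin d) →L[ℝ] EuclideanSpace ℝ (Fin d) →L[ℝ] ℝ)) ∞
    (fun x => TotalSpace.mk' (EuclideanSpace ℝ (Fin d) →L[ℝ] EuclideanSpace ℝ (Fin d) →L[ℝ] ℝ)
      (E := fun x : N => TangentSpace (𝓡 d) x →L[ℝ] TangentSpace (𝓡 d) x →L[ℝ] ℝ) x (val x))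
  index : ℕ
  index_spec : ∀ x : N, IsGreatest
    {k : ℕ | ∃ W : Submodule ℝ (TangentSpace (𝓡 d) x),
      Module.finrank ℝ W = k ∧ ∀ w ∈ W, w ≠ 0 → val x w w < 0} index

/-- The metric at `x` as a bilinear form on the tangent space. -/
def SemiRiemannianMetric.form (g : SemiRiemannianMetric d N) (x : N) :
    LinearMap.BilinForm ℝ (TangentSpace (𝓡 d) x) :=
  LinearMap.mk₂ ℝ (fun u v => g.val x u v) (by intros; simp) (by intros; simp) (by intros; simp)
    (by intros; simp)

/-- The subspace of vectors that are `g`-orthogonal to `W`. -/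
def SemiRiemannianMetric.perp (g : SemiRiemannianMetric d N) {x : N}
    (W : Submodule ℝ (TangentSpace (𝓡 d) x)) : Submodule ℝ (TangentSpace (𝓡 d) x) :=
  (g.form x).orthogonal W

/-- `cov` (with `cov Y x (X x) = (∇_X Y)(x)`) is the Levi-Civita connection of `g`: it is
torsion-free and `X g(Y, Z) = g(∇_X Y, Z) + g(Y, ∇_X Z)`. -/
structure IsLeviCivita (g : SemiRiemannianMetric d N)
    (cov : CovariantDerivative (𝓡 d) (EuclideanSpace ℝ (Fin d))
      (TangentSpace (𝓡 d) : N → Type _)) : Prop where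
  torsionFree : ∀ (X Y : Π x : N, TangentSpace (𝓡 d) x) (x : N),
    MDifferentiableAt (𝓡 d) (𝓡 d).tangent (fun y => (⟨y, X y⟩ : TangentBundle (𝓡 d) N)) x →
    MDifferentiableAt (𝓡 d) (𝓡 d).tangent (fun y => (⟨y, Y y⟩ : TangentBundle (𝓡 d) N)) x →
    cov Y x (X x) - cov X x (Y x) = VectorField.mlieBracket (𝓡 d) X Y x
  metric : ∀ (Y Z : Π x : N, TangentSpace (𝓡 d) x) (x : N) (u : TangentSpace (𝓡 d) x),
    MDifferentiableAt (𝓡 d) (𝓡 d).tangent (fun y => (⟨y, Y y⟩ : TangentBundle (𝓡 d) N)) x →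
    MDifferentiableAt (𝓡 d) (𝓡 d).tangent (fun y => (⟨y, Z y⟩ : TangentBundle (𝓡 d) N)) x →
    mvfderiv (𝓡 d) (fun y => g.val y (Y y) (Z y)) x u
      = g.val x (cov Y x u) (Z x) + g.val x (Y x) (cov Z x u)

/-- An (indefinite) almost contact metric structure `(φ, ξ, η, g)`. The 1-form `η` is smooth
because `η = g(ξ, ·)`. -/
structure AlmostContactMetric (g : SemiRiemannianMetric d N) where
  phi : Π x : N, TangentSpace (𝓡 d) x →L[ℝ] TangentSpace (𝓡 d) x
  xi : Π x : N, TangentSpace (𝓡 d) x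
  eta : Π x : N, TangentSpace (𝓡 d) x →L[ℝ] ℝ
  phi_smooth : ContMDiff (𝓡 d)
    ((𝓡 d).prod 𝓘(ℝ, EuclideanSpace ℝ (Fin d) →L[ℝ] EuclideanSpace ℝ (Fin d))) ∞
    (fun x => TotalSpace.mk' (EuclideanSpace ℝ (Fin d) →L[ℝ] EuclideanSpace ℝ (Fin d))
      (E := fun x : N => TangentSpace (𝓡 d) x →L[ℝ] TangentSpace (𝓡 d) x) x (phi x))
  xi_smooth : SmoothField xi
  phi_phi : ∀ (x : N) (u : TangentSpace (𝓡 d) x), phi x (phi x u) = -u + eta x u • xi x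
  eta_xi : ∀ x : N, eta x (xi x) = 1
  eta_phi : ∀ (x : N) (u : TangentSpace (𝓡 d) x), eta x (phi x u) = 0
  phi_xi : ∀ x : N, phi x (xi x) = 0
  metric_phi : ∀ (x : N) (u v : TangentSpace (𝓡 d) x),
    g.val x (phi x u) (phi x v) = g.val x u v - eta x u * eta x v
  eta_eq : ∀ (x : N) (u : TangentSpace (𝓡 d) x), eta x u = g.val x (xi x) u

/-- The nearly `μ`-Sasakian condition
`(∇_X φ)Y + (∇_Y φ)X = μ (2 g(X, Y) ξ - η(Y) X - η(X) Y)` for all (local) smooth vector fields,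
where `(∇_X φ)Y = ∇_X (φ Y) - φ (∇_X Y)`. -/
def IsNearlySasakian {g : SemiRiemannianMetric d N} (C : AlmostContactMetric g)
    (cov : CovariantDerivative (𝓡 d) (EuclideanSpace ℝ (Fin d))
      (TangentSpace (𝓡 d) : N → Type _)) (μ : N → ℝ) : Prop :=
  ∀ (x : N) (X Y : Π x : N, TangentSpace (𝓡 d) x), SmoothFieldAt X x → SmoothFieldAt Y x →
    (cov (fun y => C.phi y (Y y)) x (X x) - C.phi x (cov Y x (X x)))
      + (cov (fun y => C.phi y (X y)) x (Y x) - C.phi x (cov X x (Y x)))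
    = μ x • ((2 * g.val x (X x) (Y x)) • C.xi x - C.eta x (Y x) • X x - C.eta x (X x) • Y x)

end Ambient

/-! ### Vector fields and subbundles along an immersion -/

section Along

variable {d m : ℕ} {N : Type*} [TopologicalSpace N] [ChartedSpace (EuclideanSpace ℝ (Fin d)) N]
  [IsManifold (𝓡 d) ∞ N]
  {M : Type*} [TopologicalSpace M] [ChartedSpace (EuclideanSpace ℝ (Fin m)) M]

/-- The image `dι(T_pM)` of the tangent space of `M`. -/
def tangentAlong (m : ℕ) [ChartedSpace (EuclideanSpace ℝ (Fin m)) M] (ι : M → N) (p : M) :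
    Submodule ℝ (TangentSpace (𝓡 d) (ι p)) :=
  LinearMap.range (mfderiv (𝓡 m) (𝓡 d) ι p).toLinearMap

/-- The vector field `dι(X)` along `ι`, for a vector field `X` on `M`. -/
def pushField (ι : M → N) (X : Π p : M, TangentSpace (𝓡 m) p) (p : M) :
    TangentSpace (𝓡 d) (ι p) :=
  mfderiv (𝓡 m) (𝓡 d) ι p (X p)

/-- `F` is a smooth vector subbundle, of rank `k`, of the restriction of `TN` to `M`. -/
def IsSubbundleAlong (m : ℕ) [ChartedSpace (EuclideanSpace ℝ (Fin m)) M] (ι : M → N) (k : ℕ)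
    (F : Π p : M, Submodule ℝ (TangentSpace (𝓡 d) (ι p))) : Prop :=
  ∀ p₀ : M, ∃ U : Set M, IsOpen U ∧ p₀ ∈ U ∧
    ∃ s : Fin k → Π p : M, TangentSpace (𝓡 d) (ι p),
      (∀ i, ContMDiffOn (𝓡 m) (𝓡 d).tangent ∞
        (fun p => (⟨ι p, s i p⟩ : TangentBundle (𝓡 d) N)) U) ∧
      ∀ p ∈ U, LinearIndependent ℝ (fun i => s i p) ∧
        Submodule.span ℝ (Set.range fun i => s i p) = F p

/-- The covariant derivative `∇_v V` of a vector field `V` along `ι`, in the direction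
`v ∈ T_pM`. If `V = ∑ Vⁱ (eᵢ ∘ ι)` near `p`, for the local frame `eᵢ` of `TN` given by the chart at
`ι p`, then `∇_v V = ∑ (dVⁱ(v) eᵢ + Vⁱ ∇_{dι v} eᵢ)`. -/
def covAlong (cov : CovariantDerivative (𝓡 d) (EuclideanSpace ℝ (Fin d))
      (TangentSpace (𝓡 d) : N → Type _))
    (ι : M → N) (V : Π p : M, TangentSpace (𝓡 d) (ι p)) (p : M) (v : TangentSpace (𝓡 m) p) :
    TangentSpace (𝓡 d) (ι p) :=
  let e := trivializationAt (EuclideanSpace ℝ (Fin d)) (TangentSpace (𝓡 d) : N → Type _) (ι p)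
  let b := (EuclideanSpace.basisFun (Fin d) ℝ).toBasis
  ∑ i, (mvfderiv (𝓡 m) (fun q => e.localFrameCoeff (𝓡 d) b i (ι q) (V q)) p v
          • e.localFrame b i (ι p)
        + e.localFrameCoeff (𝓡 d) b i (ι p) (V p)
          • cov (e.localFrame b i) (ι p) (mfderiv (𝓡 m) (𝓡 d) ι p v))

end Along

/-! ### Lightlike submanifolds -/

section Lightlike

variable {d m : ℕ} {N : Type*} [TopologicalSpace N] [ChartedSpace (EuclideanSpace ℝ (Fin d)) N]
  [IsManifold (𝓡 d) ∞ N]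
  {M : Type*} [TopologicalSpace M] [ChartedSpace (EuclideanSpace ℝ (Fin m)) M]

/-- The normal space `T_pM^⊥`. -/
def normalAlong (g : SemiRiemannianMetric d N) (m : ℕ)
    [ChartedSpace (EuclideanSpace ℝ (Fin m)) M] (ι : M → N) (p : M) :
    Submodule ℝ (TangentSpace (𝓡 d) (ι p)) :=
  g.perp (tangentAlong m ι p)

/-- The radical `Rad T_pM = T_pM ∩ T_pM^⊥`. -/
def radAlong (g : SemiRiemannianMetric d N) (m : ℕ)
    [ChartedSpace (EuclideanSpace ℝ (Fin m)) M] (ι : M → N) (p : M) :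
    Submodule ℝ (TangentSpace (𝓡 d) (ι p)) :=
  tangentAlong m ι p ⊓ normalAlong g m ι p

/-- An `r`-lightlike (immersed) submanifold `(M, g, S(TM), S(TM^⊥))` with its lightlike transversal
bundle. All bundles over `M` are regarded as subbundles of `TN` restricted to `M`. -/
structure LightlikeSubmanifold (g : SemiRiemannianMetric d N) (m : ℕ) (M : Type*)
    [TopologicalSpace M] [ChartedSpace (EuclideanSpace ℝ (Fin m)) M] where
  /-- the immersion of `M` -/
  ι : M → N
  ι_smooth : ContMDiff (𝓡 m) (𝓡 d) ∞ ι
  ι_immersion : ∀ p : M, Function.Injective (mfderiv (𝓡 m) (𝓡 d) ι p)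
  r : ℕ
  r_pos : 0 < r
  rad_subbundle : IsSubbundleAlong m ι r (radAlong g m ι)
  /-- the screen distribution `S(TM)`, a semi-Riemannian complement of `Rad TM` in `TM` -/
  screen : Π p : M, Submodule ℝ (TangentSpace (𝓡 d) (ι p))
  screen_subbundle : ∃ k, IsSubbundleAlong m ι k screen
  rad_inf_screen : ∀ p, radAlong g m ι p ⊓ screen p = ⊥
  rad_sup_screen : ∀ p, radAlong g m ι p ⊔ screen p = tangentAlong m ι p
  screen_nondegenerate : ∀ p, screen p ⊓ g.perp (screen p) = ⊥
  /-- the screen transversal bundle `S(TM^⊥)`, a semi-Riemannian complement of `Rad TM` in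
  `TM^⊥` -/
  screenTr : Π p : M, Submodule ℝ (TangentSpace (𝓡 d) (ι p))
  screenTr_subbundle : ∃ k, IsSubbundleAlong m ι k screenTr
  rad_inf_screenTr : ∀ p, radAlong g m ι p ⊓ screenTr p = ⊥
  rad_sup_screenTr : ∀ p, radAlong g m ι p ⊔ screenTr p = normalAlong g m ι p
  screenTr_nondegenerate : ∀ p, screenTr p ⊓ g.perp (screenTr p) = ⊥
  /-- the lightlike transversal bundle `ltr(TM)`: a totally null complement of `Rad TM` in the
  orthogonal complement of `S(TM) ⊥ S(TM^⊥)`; equivalently, every local frame `E_i` of `Rad TM` has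
  a dual null frame `N_i` of `ltr(TM)`, with `g(E_i, N_j) = δ_ij` and `g(N_i, N_j) = 0` -/
  ltr : Π p : M, Submodule ℝ (TangentSpace (𝓡 d) (ι p))
  ltr_subbundle : IsSubbundleAlong m ι r ltr
  ltr_null : ∀ p, ltr p ≤ g.perp (ltr p)
  rad_inf_ltr : ∀ p, radAlong g m ι p ⊓ ltr p = ⊥
  rad_sup_ltr : ∀ p, radAlong g m ι p ⊔ ltr p = g.perp (screen p ⊔ screenTr p)

variable {g : SemiRiemannianMetric d N}

theorem SemiRiemannianMetric.mem_perp {x : N} {W : Submodule ℝ (TangentSpace (𝓡 d) x)}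
    {v : TangentSpace (𝓡 d) x} : v ∈ g.perp W ↔ ∀ w ∈ W, g.val x w v = 0 := Iff.rfl

theorem SemiRiemannianMetric.sup_perp {x : N} {W : Submodule ℝ (TangentSpace (𝓡 d) x)}
    (h : W ⊓ g.perp W = ⊥) : W ⊔ g.perp W = ⊤ := by
  have hr : (g.form x).IsRefl := by
    intro u v huv
    change g.val x v u = 0
    rw [g.symm]
    exact huv
  have : FiniteDimensional ℝ (TangentSpace (𝓡 d) x) :=
    inferInstanceAs (FiniteDimensional ℝ (EuclideanSpace ℝ (Fin d)))
  exact ((LinearMap.BilinForm.isCompl_orthogonal_iff_disjoint hr).2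
    (disjoint_iff.2 h)).sup_eq_top

namespace LightlikeSubmanifold

variable (L : LightlikeSubmanifold g m M)

/-- `TM`, as a subbundle of `TN` along `M`. -/
def tan (p : M) : Submodule ℝ (TangentSpace (𝓡 d) (L.ι p)) := tangentAlong m L.ι p

/-- `Rad TM`. -/
def rad (p : M) : Submodule ℝ (TangentSpace (𝓡 d) (L.ι p)) := radAlong g m L.ι p

/-- The transversal bundle `tr(TM) = ltr(TM) ⊥ S(TM^⊥)`. -/
def tr (p : M) : Submodule ℝ (TangentSpace (𝓡 d) (L.ι p)) := L.ltr p ⊔ L.screenTr p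

/-- `TN = TM ⊕ tr(TM)` along `M`. -/
theorem isCompl_tan_tr (p : M) : IsCompl (L.tan p) (L.tr p) := by
  have hST : ∀ s ∈ L.screen p, ∀ t ∈ L.screenTr p, g.val _ s t = 0 := by
    intro s hs t ht
    have h1 : s ∈ tangentAlong m L.ι p := by
      rw [← L.rad_sup_screen p]; exact Submodule.mem_sup_right hs
    have h2 : t ∈ normalAlong g m L.ι p := by
      rw [← L.rad_sup_screenTr p]; exact Submodule.mem_sup_right ht
    exact h2 s h1
  have hl : ∀ l ∈ L.ltr p, l ∈ g.perp (L.screen p ⊔ L.screenTr p) := by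
    intro l h
    rw [← L.rad_sup_ltr p]; exact Submodule.mem_sup_right h
  have he : ∀ e ∈ radAlong g m L.ι p, e ∈ g.perp (L.screen p ⊔ L.screenTr p) := by
    intro e h
    rw [← L.rad_sup_ltr p]; exact Submodule.mem_sup_left h
  have hS : ∀ s ∈ L.screen p, (∀ s' ∈ L.screen p, g.val _ s' s = 0) → s = 0 := by
    intro s hs h
    have : s ∈ L.screen p ⊓ g.perp (L.screen p) := ⟨hs, h⟩
    rw [L.screen_nondegenerate p] at this
    simpa using this
  have hT : ∀ s ∈ L.screenTr p, (∀ s' ∈ L.screenTr p, g.val _ s' s = 0) → s = 0 := by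
    intro s hs h
    have : s ∈ L.screenTr p ⊓ g.perp (L.screenTr p) := ⟨hs, h⟩
    rw [L.screenTr_nondegenerate p] at this
    simpa using this
  constructor
  · rw [Submodule.disjoint_def]
    intro x hx hx'
    obtain ⟨l, hl', t, ht, rfl⟩ := Submodule.mem_sup.1 hx'
    have ht0 : t = 0 := by
      refine hT t ht fun t' ht' => ?_
      have h1 : t' ∈ normalAlong g m L.ι p := by
        rw [← L.rad_sup_screenTr p]; exact Submodule.mem_sup_right ht'
      have h2 : g.val _ (l + t) t' = 0 := h1 _ hx
      have h3 : g.val _ t' l = 0 := hl l hl' t' (Submodule.mem_sup_right ht')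
      rw [g.symm, map_add, h3, zero_add] at h2
      exact h2
    subst ht0
    rw [add_zero] at hx ⊢
    have hx2 : l ∈ radAlong g m L.ι p ⊔ L.screen p := by rw [L.rad_sup_screen p]; exact hx
    obtain ⟨e, he', s, hs, rfl⟩ := Submodule.mem_sup.1 hx2
    have hs0 : s = 0 := by
      refine hS s hs fun s' hs' => ?_
      have h1 : g.val _ s' (e + s) = 0 := hl _ hl' s' (Submodule.mem_sup_left hs')
      have h2 : g.val _ s' e = 0 := he e he' s' (Submodule.mem_sup_left hs')
      rw [map_add, h2, zero_add] at h1
      exact h1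
    subst hs0
    rw [add_zero] at hl' ⊢
    have : e ∈ radAlong g m L.ι p ⊓ L.ltr p := ⟨he', hl'⟩
    rw [L.rad_inf_ltr p] at this
    simpa using this
  · have hnd : (L.screen p ⊔ L.screenTr p) ⊓ g.perp (L.screen p ⊔ L.screenTr p) = ⊥ := by
      rw [eq_bot_iff]
      rintro x ⟨hx, hx'⟩
      obtain ⟨s, hs, t, ht, rfl⟩ := Submodule.mem_sup.1 hx
      have hs0 : s = 0 := by
        refine hS s hs fun s' hs' => ?_
        have h1 : g.val _ s' (s + t) = 0 := hx' s' (Submodule.mem_sup_left hs')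
        rw [map_add, hST s' hs' t ht, add_zero] at h1
        exact h1
      have ht0 : t = 0 := by
        refine hT t ht fun t' ht' => ?_
        have h1 : g.val _ t' (s + t) = 0 := hx' t' (Submodule.mem_sup_right ht')
        rw [map_add, g.symm _ t' s, hST s hs t' ht', zero_add] at h1
        exact h1
      simp [hs0, ht0]
    rw [codisjoint_iff, eq_top_iff, ← SemiRiemannianMetric.sup_perp hnd, ← L.rad_sup_ltr p]
    change _ ≤ tangentAlong m L.ι p ⊔ (L.ltr p ⊔ L.screenTr p)
    rw [← L.rad_sup_screen p]
    simp only [sup_le_iff]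
    refine ⟨⟨?_, ?_⟩, ?_, ?_⟩
    · exact le_sup_right.trans le_sup_left
    · exact le_sup_right.trans le_sup_right
    · exact le_sup_left.trans le_sup_left
    · exact le_sup_left.trans le_sup_right

/-- The tangential component with respect to `TN = TM ⊕ tr(TM)`. -/
def tanProj (p : M) : TangentSpace (𝓡 d) (L.ι p) →ₗ[ℝ] TangentSpace (𝓡 d) (L.ι p) :=
  (L.tan p).projection (L.tr p) (L.isCompl_tan_tr p)

/-- The transversal component with respect to `TN = TM ⊕ tr(TM)`. -/
def trProj (p : M) : TangentSpace (𝓡 d) (L.ι p) →ₗ[ℝ] TangentSpace (𝓡 d) (L.ι p) :=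
  (L.tr p).projection (L.tan p) (L.isCompl_tan_tr p).symm

variable (cov : CovariantDerivative (𝓡 d) (EuclideanSpace ℝ (Fin d))
  (TangentSpace (𝓡 d) : N → Type _))

/-- The induced connection on `TM`: `∇_X W` is the tangential part of the ambient covariant
derivative, by the Gauss formula `∇̄_X W = ∇_X W + h(X, W)`, for `W ∈ Γ(TM)`. -/
def indConn (X : Π p : M, TangentSpace (𝓡 m) p) (W : Π p : M, TangentSpace (𝓡 d) (L.ι p)) (p : M) :
    TangentSpace (𝓡 d) (L.ι p) :=
  L.tanProj p (covAlong cov L.ι W p (X p))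

/-- The shape operator `A_V X`, by the Weingarten formula `∇̄_X V = -A_V X + ∇^t_X V`, for
`V ∈ Γ(tr(TM))`. -/
def shape (V : Π p : M, TangentSpace (𝓡 d) (L.ι p)) (X : Π p : M, TangentSpace (𝓡 m) p) (p : M) :
    TangentSpace (𝓡 d) (L.ι p) :=
  -L.tanProj p (covAlong cov L.ι V p (X p))

/-- `F ⊆ TM` is nearly parallel: `∇_X Y + ∇_Y X ∈ Γ(F)` for all `X ∈ Γ(TM)` and `Y ∈ Γ(F)`. -/
def IsNearlyParallel [IsManifold (𝓡 m) ∞ M]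
    (F : Π p : M, Submodule ℝ (TangentSpace (𝓡 d) (L.ι p))) : Prop :=
  ∀ X Y : Π p : M, TangentSpace (𝓡 m) p, SmoothField X → SmoothField Y →
    (∀ p, pushField L.ι Y p ∈ F p) →
    ∀ p, L.indConn cov X (pushField L.ι Y) p + L.indConn cov Y (pushField L.ι X) p ∈ F p

variable (C : AlmostContactMetric g)

/-- The image `φ F` of a family of subspaces along `M`. -/
def phiMap (F : Π p : M, Submodule ℝ (TangentSpace (𝓡 d) (L.ι p))) (p : M) :
    Submodule ℝ (TangentSpace (𝓡 d) (L.ι p)) :=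
  (F p).map (C.phi (L.ι p)).toLinearMap

/-- `φ Z`, for a vector field `Z` along `M`. -/
def phiField (Z : Π p : M, TangentSpace (𝓡 d) (L.ι p)) (p : M) : TangentSpace (𝓡 d) (L.ι p) :=
  C.phi (L.ι p) (Z p)

/-- `φ₁ X`, the component of `φ X` in `TM`. -/
def phiTan (X : Π p : M, TangentSpace (𝓡 m) p) (p : M) : TangentSpace (𝓡 d) (L.ι p) :=
  L.tanProj p (C.phi (L.ι p) (pushField L.ι X p))

/-- `ϕ₁ X`, the component of `φ X` in `tr(TM)`. -/
def phiTr (X : Π p : M, TangentSpace (𝓡 m) p) (p : M) : TangentSpace (𝓡 d) (L.ι p) :=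
  L.trProj p (C.phi (L.ι p) (pushField L.ι X p))

end LightlikeSubmanifold

/-! ### QGCR-lightlike submanifolds -/

/-- The structure of a quasi generalized CR (QGCR) lightlike submanifold. Here `DL` and `DS` are
the subbundles `𝓛 ⊆ ltr(TM)` and `𝓢 ⊆ S(TM^⊥)`. -/
structure QGCRStructure (C : AlmostContactMetric g) (L : LightlikeSubmanifold g m M) where
  D₁ : Π p : M, Submodule ℝ (TangentSpace (𝓡 d) (L.ι p))
  D₂ : Π p : M, Submodule ℝ (TangentSpace (𝓡 d) (L.ι p))
  D₀ : Π p : M, Submodule ℝ (TangentSpace (𝓡 d) (L.ι p))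
  Dbar : Π p : M, Submodule ℝ (TangentSpace (𝓡 d) (L.ι p))
  DL : Π p : M, Submodule ℝ (TangentSpace (𝓡 d) (L.ι p))
  DS : Π p : M, Submodule ℝ (TangentSpace (𝓡 d) (L.ι p))
  D₁_subbundle : ∃ k, IsSubbundleAlong m L.ι k D₁
  D₂_subbundle : ∃ k, IsSubbundleAlong m L.ι k D₂
  D₀_subbundle : ∃ k, IsSubbundleAlong m L.ι k D₀
  Dbar_subbundle : ∃ k, IsSubbundleAlong m L.ι k Dbar
  DL_subbundle : ∃ k, IsSubbundleAlong m L.ι k DL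
  DS_subbundle : ∃ k, IsSubbundleAlong m L.ι k DS
  /- `Rad TM = D₁ ⊕ D₂`, `φ D₁ = D₁`, `φ D₂ ⊆ S(TM)` -/
  D₁_inf_D₂ : ∀ p, D₁ p ⊓ D₂ p = ⊥
  D₁_sup_D₂ : ∀ p, D₁ p ⊔ D₂ p = L.rad p
  phi_D₁ : ∀ p, L.phiMap C D₁ p = D₁ p
  phi_D₂ : ∀ p, L.phiMap C D₂ p ≤ L.screen p
  /- `S(TM) = (φ D₂ ⊕ Dbar) ⊥ D₀`, with `D₀` nondegenerate and `φ D₀ ⊆ D₀` -/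
  phi_D₂_inf_Dbar : ∀ p, L.phiMap C D₂ p ⊓ Dbar p = ⊥
  sup_inf_D₀ : ∀ p, (L.phiMap C D₂ p ⊔ Dbar p) ⊓ D₀ p = ⊥
  sup_sup_D₀ : ∀ p, (L.phiMap C D₂ p ⊔ Dbar p) ⊔ D₀ p = L.screen p
  D₀_orthogonal : ∀ p, D₀ p ≤ g.perp (L.phiMap C D₂ p ⊔ Dbar p)
  D₀_nondegenerate : ∀ p, D₀ p ⊓ g.perp (D₀ p) = ⊥
  phi_D₀ : ∀ p, L.phiMap C D₀ p ≤ D₀ p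
  /- `Dbar = φ 𝓢 ⊕ φ 𝓛`, with `𝓛 ⊆ ltr(TM)` and `𝓢 ⊆ S(TM^⊥)` -/
  DL_le : ∀ p, DL p ≤ L.ltr p
  DS_le : ∀ p, DS p ≤ L.screenTr p
  phi_DS_inf_phi_DL : ∀ p, L.phiMap C DS p ⊓ L.phiMap C DL p = ⊥
  Dbar_eq : ∀ p, Dbar p = L.phiMap C DS p ⊔ L.phiMap C DL p

namespace QGCRStructure

variable {C : AlmostContactMetric g} {L : LightlikeSubmanifold g m M} (Q : QGCRStructure C L)

/-- Co-screen: `ξ ∈ Γ(S(TM^⊥))`. -/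
def IsCoScreen (_Q : QGCRStructure C L) : Prop := ∀ p : M, C.xi (L.ι p) ∈ L.screenTr p

/-- `D = Rad TM ⊥ D₀ ⊥ φ D₂`. -/
def D (p : M) : Submodule ℝ (TangentSpace (𝓡 d) (L.ι p)) :=
  L.rad p ⊔ Q.D₀ p ⊔ L.phiMap C Q.D₂ p

/-- `TM = D ⊕ Dbar`. -/
theorem D_inf_Dbar (p : M) : Q.D p ⊓ Q.Dbar p = ⊥ := by
  have h1 : Disjoint (Q.Dbar p) (L.phiMap C Q.D₂ p) :=
    (disjoint_iff.2 (Q.phi_D₂_inf_Dbar p)).symm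
  have h2 : Disjoint (Q.Dbar p ⊔ L.phiMap C Q.D₂ p) (Q.D₀ p) := by
    rw [sup_comm]; exact disjoint_iff.2 (Q.sup_inf_D₀ p)
  have h3 := h1.disjoint_sup_right_of_disjoint_sup_left h2
  have h4 : Disjoint (Q.Dbar p ⊔ (L.phiMap C Q.D₂ p ⊔ Q.D₀ p)) (L.rad p) := by
    rw [← sup_assoc, sup_comm (Q.Dbar p), Q.sup_sup_D₀ p]
    exact (disjoint_iff.2 (L.rad_inf_screen p)).symm
  have h5 := h3.disjoint_sup_right_of_disjoint_sup_left h4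
  have h6 : Q.D p = L.phiMap C Q.D₂ p ⊔ Q.D₀ p ⊔ L.rad p := by
    unfold D; ac_rfl
  rw [h6]
  exact disjoint_iff.1 h5.symm

theorem D_sup_Dbar (p : M) : Q.D p ⊔ Q.Dbar p = L.tan p := by
  have h := L.rad_sup_screen p
  rw [← Q.sup_sup_D₀ p] at h
  have h6 : Q.D p ⊔ Q.Dbar p
      = radAlong g m L.ι p ⊔ (L.phiMap C Q.D₂ p ⊔ Q.Dbar p ⊔ Q.D₀ p) := by
    unfold D LightlikeSubmanifold.rad; ac_rfl
  rw [h6, h]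
  rfl

theorem isCompl_D (p : M) : IsCompl (Q.D p) (Q.Dbar p ⊔ L.tr p) := by
  have h := L.isCompl_tan_tr p
  rw [← Q.D_sup_Dbar p] at h
  refine ⟨(disjoint_iff.2 (Q.D_inf_Dbar p)).disjoint_sup_right_of_disjoint_sup_left h.disjoint, ?_⟩
  rw [codisjoint_iff, ← sup_assoc]
  exact h.sup_eq_top

/-- The component in `D` with respect to `TN = TM ⊕ tr(TM) = D ⊕ Dbar ⊕ tr(TM)`; on `TM = D ⊕ Dbar`
it is the projection onto `D`. -/
def DProj (p : M) : TangentSpace (𝓡 d) (L.ι p) →ₗ[ℝ] TangentSpace (𝓡 d) (L.ι p) :=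
  (Q.D p).projection (Q.Dbar p ⊔ L.tr p) (Q.isCompl_D p)

/-- `tr(TM) = φ Dbar ⊥ 𝒢 ⊥ ℝξ` with `φ 𝒢 = 𝒢`, at every point. -/
structure IsInvariantComplement (G : Π p : M, Submodule ℝ (TangentSpace (𝓡 d) (L.ι p))) :
    Prop where
  sup_eq : ∀ p, L.phiMap C Q.Dbar p ⊔ G p ⊔ Submodule.span ℝ {C.xi (L.ι p)} = L.tr p
  inf_eq : ∀ p, L.phiMap C Q.Dbar p ⊓ G p = ⊥
  inf_xi_eq : ∀ p, (L.phiMap C Q.Dbar p ⊔ G p) ⊓ Submodule.span ℝ {C.xi (L.ι p)} = ⊥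
  orthogonal : ∀ p, G p ≤ g.perp (L.phiMap C Q.Dbar p)
  orthogonal_xi : ∀ p, C.xi (L.ι p) ∈ g.perp (L.phiMap C Q.Dbar p ⊔ G p)
  phi_eq : ∀ p, L.phiMap C G p = G p

end QGCRStructure

end Lightlike

end

/-! Both claims concern the tangential part of `∇̄_X φY + ∇̄_Y φX`: splitting `φX = φ₁X + ϕ₁X` and
applying Gauss and Weingarten shows that the given vector is exactly that.

For (ii), the product rule and the nearly Sasakian identity turn this sum into `φ(∇̄_X Y + ∇̄_Y X)`
plus `μ` times a combination of `ξ`, `X` and `Y`. Co-screen puts `ξ` in `tr(TM)` and makes `η`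
vanish on `TM`, so only the `ξ` term survives, and it is transversal. By hypothesis `∇̄_X Y + ∇̄_Y
X` lies in `Dbar ⊕ tr(TM)` at `p`. The decomposition of `tr(TM)` makes this space `φ`-invariant
(`IsInvariantComplement.phi_mem`), and it is the kernel of the projection onto `D`.

For (i), the hypothesis ranges over all `X`, and `∇_X Y + ∇_Y X` is not tensorial in `X`: replacing
`X` by `fX` adds `Y(f) X`. As `Rad TM ≠ 0` meets `Dbar` trivially, `X` can be chosen outside `Dbar`,
which forces `Y = 0` (`IsNearlyParallel.eq_zero`), and every term vanishes.

The analytic work is a calculus for fields along an immersion: Leibniz rule, `∇̄φ` as a tensor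
(`covAlong_phi`), and differentiability of `φ₁X` and `ϕ₁X` (`diffAlongAt_projection`). -/

noncomputable section

/-! ### Covariant differentiation of vector fields along a map. -/

section AlongCalculus

variable {d m : ℕ} {N : Type*} [TopologicalSpace N] [ChartedSpace (EuclideanSpace ℝ (Fin d)) N]
  [IsManifold (𝓡 d) ∞ N]
  {M : Type*} [TopologicalSpace M] [ChartedSpace (EuclideanSpace ℝ (Fin m)) M]

/-- The vector field `V` along `ι` is differentiable at `p`. -/
def DiffAlongAt (m : ℕ) [ChartedSpace (EuclideanSpace ℝ (Fin m)) M] (ι : M → N)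
    (V : Π p : M, TangentSpace (𝓡 d) (ι p)) (p : M) : Prop :=
  MDifferentiableAt (𝓡 m) (𝓡 d).tangent (fun q => (⟨ι q, V q⟩ : TangentBundle (𝓡 d) N)) p

/-- The `i`-th vector field of the local frame given by the chart at `x`. -/
def chartFrame (x : N) (i : Fin d) : Π y : N, TangentSpace (𝓡 d) y :=
  (trivializationAt (EuclideanSpace ℝ (Fin d)) (TangentSpace (𝓡 d) : N → Type _) x).localFrame
    (EuclideanSpace.basisFun (Fin d) ℝ).toBasis i

/-- The `i`-th coefficient with respect to the local frame given by the chart at `x`. -/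
def chartCoeff (x : N) (i : Fin d) (y : N) : TangentSpace (𝓡 d) y →ₗ[ℝ] ℝ :=
  (trivializationAt (EuclideanSpace ℝ (Fin d)) (TangentSpace (𝓡 d) : N → Type _) x).localFrameCoeff
    (𝓡 d) (EuclideanSpace.basisFun (Fin d) ℝ).toBasis i y

theorem chart_baseSet_mem_nhds (x : N) :
    (trivializationAt (EuclideanSpace ℝ (Fin d)) (TangentSpace (𝓡 d) : N → Type _) x).baseSet
      ∈ 𝓝 x :=
  (Trivialization.open_baseSet _).mem_nhds (FiberBundle.mem_baseSet_trivializationAt' x)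

theorem sum_chartCoeff_smul_chartFrame {x y : N}
    (hy : y ∈ (trivializationAt (EuclideanSpace ℝ (Fin d))
      (TangentSpace (𝓡 d) : N → Type _) x).baseSet) (v : TangentSpace (𝓡 d) y) :
    v = ∑ i, chartCoeff x i y v • chartFrame x i y := by
  have h := Trivialization.eq_sum_localFrameCoeff_smul (I := 𝓡 d)
    (e := trivializationAt (EuclideanSpace ℝ (Fin d)) (TangentSpace (𝓡 d) : N → Type _) x)
    (b := (EuclideanSpace.basisFun (Fin d) ℝ).toBasis)
    (s := FiberBundle.extend (EuclideanSpace ℝ (Fin d)) v) hy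
  simpa [chartCoeff, chartFrame] using h

theorem chartCoeff_eq {x y : N}
    (hy : y ∈ (trivializationAt (EuclideanSpace ℝ (Fin d))
      (TangentSpace (𝓡 d) : N → Type _) x).baseSet) (i : Fin d) (v : TangentSpace (𝓡 d) y) :
    chartCoeff x i y v = ((trivializationAt (EuclideanSpace ℝ (Fin d))
      (TangentSpace (𝓡 d) : N → Type _) x) ⟨y, v⟩).2 i := by
  have h := Trivialization.localFrameCoeff_eq_coeff (I := 𝓡 d)
    (e := trivializationAt (EuclideanSpace ℝ (Fin d)) (TangentSpace (𝓡 d) : N → Type _) x)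
    (b := (EuclideanSpace.basisFun (Fin d) ℝ).toBasis)
    (s := FiberBundle.extend (EuclideanSpace ℝ (Fin d)) v) hy (i := i)
  simpa [chartCoeff] using h

theorem mdifferentiableAt_euclidean_iff {p : M} {f : M → EuclideanSpace ℝ (Fin d)} :
    MDifferentiableAt (𝓡 m) 𝓘(ℝ, EuclideanSpace ℝ (Fin d)) f p ↔
      ∀ i, MDifferentiableAt (𝓡 m) 𝓘(ℝ, ℝ) (fun q => f q i) p := by
  constructor
  · intro h i
    exact (EuclideanSpace.proj i : EuclideanSpace ℝ (Fin d) →L[ℝ] ℝ).mdifferentiableAt.comp p h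
  · intro h
    have : f = ∑ i, (fun q => f q i) • fun _ => (EuclideanSpace.basisFun (Fin d) ℝ i) := by
      funext q
      simpa using ((EuclideanSpace.basisFun (Fin d) ℝ).sum_repr (f q)).symm
    rw [this]
    exact MDifferentiableAt.sum fun i _ => (h i).smul mdifferentiableAt_const

/-- Reduces differentiability along `ι` to scalar functions. Frame coefficients and trivialization
coordinates agree only over the chart's base set, hence the eventual equality near `p`. -/
theorem diffAlongAt_iff {ι : M → N} {p : M} (hι : MDifferentiableAt (𝓡 m) (𝓡 d) ι p)
    {V : Π p : M, TangentSpace (𝓡 d) (ι p)} :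
    DiffAlongAt m ι V p ↔
      ∀ i, MDifferentiableAt (𝓡 m) 𝓘(ℝ, ℝ) (fun q => chartCoeff (ι p) i (ι q) (V q)) p := by
  rw [DiffAlongAt, mdifferentiableAt_totalSpace, and_iff_right hι,
    mdifferentiableAt_euclidean_iff]
  refine forall_congr' fun i => Filter.EventuallyEq.mdifferentiableAt_iff ?_
  filter_upwards [hι.continuousAt.preimage_mem_nhds (chart_baseSet_mem_nhds (d := d) (ι p))] with q hq
  exact (chartCoeff_eq hq i (V q)).symm

variable {ι : M → N} {p : M}

theorem DiffAlongAt.add (hι : MDifferentiableAt (𝓡 m) (𝓡 d) ι p)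
    {V W : Π p : M, TangentSpace (𝓡 d) (ι p)}
    (hV : DiffAlongAt m ι V p) (hW : DiffAlongAt m ι W p) :
    DiffAlongAt m ι (fun q => V q + W q) p := by
  rw [diffAlongAt_iff hι] at *
  intro i
  simp only [map_add]
  exact (hV i).add (hW i)

theorem DiffAlongAt.smul (hι : MDifferentiableAt (𝓡 m) (𝓡 d) ι p)
    {f : M → ℝ} {V : Π p : M, TangentSpace (𝓡 d) (ι p)}
    (hf : MDifferentiableAt (𝓡 m) 𝓘(ℝ, ℝ) f p) (hV : DiffAlongAt m ι V p) :
    DiffAlongAt m ι (fun q => f q • V q) p := by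
  rw [diffAlongAt_iff hι] at *
  intro i
  simp only [map_smul]
  exact hf.smul (hV i)

theorem DiffAlongAt.zero (hι : MDifferentiableAt (𝓡 m) (𝓡 d) ι p) :
    DiffAlongAt m ι (fun q => (0 : TangentSpace (𝓡 d) (ι q))) p := by
  rw [diffAlongAt_iff hι]
  intro i
  simpa only [map_zero] using mdifferentiableAt_const

theorem DiffAlongAt.sum (hι : MDifferentiableAt (𝓡 m) (𝓡 d) ι p) {κ : Type*} (s : Finset κ)
    {V : κ → Π p : M, TangentSpace (𝓡 d) (ι p)} (hV : ∀ i ∈ s, DiffAlongAt m ι (V i) p) :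
    DiffAlongAt m ι (fun q => ∑ i ∈ s, V i q) p := by
  classical
  induction s using Finset.induction_on with
  | empty => simpa using DiffAlongAt.zero hι
  | insert a s ha ih =>
    simp only [Finset.sum_insert ha]
    exact (hV a (by simp)).add hι (ih fun i hi => hV i (by simp [hi]))

theorem DiffAlongAt.congr {V W : Π p : M, TangentSpace (𝓡 d) (ι p)}
    (hV : DiffAlongAt m ι V p) (h : ∀ᶠ q in 𝓝 p, W q = V q) : DiffAlongAt m ι W p :=
  MDifferentiableAt.congr_of_eventuallyEq hV (h.mono fun q hq => by simp only [hq])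

theorem DiffAlongAt.comp (hι : MDifferentiableAt (𝓡 m) (𝓡 d) ι p)
    {W : Π x : N, TangentSpace (𝓡 d) x}
    (hW : MDifferentiableAt (𝓡 d) (𝓡 d).tangent (fun y => (⟨y, W y⟩ : TangentBundle (𝓡 d) N))
      (ι p)) :
    DiffAlongAt m ι (fun q => W (ι q)) p :=
  MDifferentiableAt.comp p hW hι

theorem mdifferentiableAt_chartFrame (x : N) (i : Fin d) :
    MDifferentiableAt (𝓡 d) (𝓡 d).tangent
      (fun y => (⟨y, chartFrame x i y⟩ : TangentBundle (𝓡 d) N)) x :=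
  (contMDiffAt_localFrame_of_mem (I := 𝓡 d) 1 _ (EuclideanSpace.basisFun (Fin d) ℝ).toBasis i
    (FiberBundle.mem_baseSet_trivializationAt' x)).mdifferentiableAt one_ne_zero

/-- A field on `N` is a field along `id`, so the calculus along maps also serves ambient fields. -/
theorem mdifferentiableAt_chartCoeff {x : N} {W : Π x : N, TangentSpace (𝓡 d) x}
    (hW : MDifferentiableAt (𝓡 d) (𝓡 d).tangent (fun y => (⟨y, W y⟩ : TangentBundle (𝓡 d) N)) x)
    (i : Fin d) : MDifferentiableAt (𝓡 d) 𝓘(ℝ, ℝ) (fun y => chartCoeff x i y (W y)) x :=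
  (diffAlongAt_iff (ι := id) mdifferentiableAt_id).1 hW i

theorem mvfderiv_congr {f f' : M → ℝ} (h : f =ᶠ[𝓝 p] f') :
    mvfderiv (𝓡 m) f p = mvfderiv (𝓡 m) f' p := by
  ext v
  simp only [mvfderiv, h.mfderiv_eq]
  rfl

variable (cov : CovariantDerivative (𝓡 d) (EuclideanSpace ℝ (Fin d))
  (TangentSpace (𝓡 d) : N → Type _))

theorem covAlong_eq (V : Π p : M, TangentSpace (𝓡 d) (ι p)) (v : TangentSpace (𝓡 m) p) :
    covAlong cov ι V p v =
      ∑ i, (mvfderiv (𝓡 m) (fun q => chartCoeff (ι p) i (ι q) (V q)) p v • chartFrame (ι p) i (ι p)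
        + chartCoeff (ι p) i (ι p) (V p)
          • cov (chartFrame (ι p) i) (ι p) (mfderiv (𝓡 m) (𝓡 d) ι p v)) := rfl

theorem covAlong_congr {V W : Π p : M, TangentSpace (𝓡 d) (ι p)} (h : ∀ᶠ q in 𝓝 p, V q = W q)
    (v : TangentSpace (𝓡 m) p) : covAlong cov ι V p v = covAlong cov ι W p v := by
  rw [covAlong_eq, covAlong_eq]
  refine Finset.sum_congr rfl fun i _ => ?_
  rw [h.self_of_nhds, mvfderiv_congr (m := m) (f := fun q => chartCoeff (ι p) i (ι q) (V q))
    (f' := fun q => chartCoeff (ι p) i (ι q) (W q)) (h.mono fun q hq => by simp only [hq])]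

theorem covAlong_zero_right (V : Π p : M, TangentSpace (𝓡 d) (ι p)) :
    covAlong cov ι V p (0 : TangentSpace (𝓡 m) p) = 0 := by
  simp [covAlong_eq]

theorem covAlong_zero (v : TangentSpace (𝓡 m) p) :
    covAlong cov ι (fun q => (0 : TangentSpace (𝓡 d) (ι q))) p v = 0 := by
  simp [covAlong_eq, mvfderiv_const]

theorem covAlong_add (hι : MDifferentiableAt (𝓡 m) (𝓡 d) ι p)
    {V W : Π p : M, TangentSpace (𝓡 d) (ι p)}
    (hV : DiffAlongAt m ι V p) (hW : DiffAlongAt m ι W p) (v : TangentSpace (𝓡 m) p) :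
    covAlong cov ι (fun q => V q + W q) p v = covAlong cov ι V p v + covAlong cov ι W p v := by
  rw [diffAlongAt_iff hι] at hV hW
  simp only [covAlong_eq, ← Finset.sum_add_distrib]
  refine Finset.sum_congr rfl fun i _ => ?_
  simp only [map_add]
  rw [mvfderiv_fun_add (hV i) (hW i), _root_.add_apply]
  module

theorem covAlong_smul (hι : MDifferentiableAt (𝓡 m) (𝓡 d) ι p) {f : M → ℝ}
    {V : Π p : M, TangentSpace (𝓡 d) (ι p)} (hf : MDifferentiableAt (𝓡 m) 𝓘(ℝ, ℝ) f p)
    (hV : DiffAlongAt m ι V p) (v : TangentSpace (𝓡 m) p) :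
    covAlong cov ι (fun q => f q • V q) p v
      = f p • covAlong cov ι V p v + mvfderiv (𝓡 m) f p v • V p := by
  rw [diffAlongAt_iff hι] at hV
  have h := sum_chartCoeff_smul_chartFrame
    (mem_of_mem_nhds (chart_baseSet_mem_nhds (d := d) (ι p))) (V p)
  -- Expanding the `V p` of the term `df(v) V p` in the chart frame allows a comparison frame vector
  -- by frame vector.
  conv_rhs => rw [h]
  simp only [covAlong_eq, Finset.smul_sum, ← Finset.sum_add_distrib]
  refine Finset.sum_congr rfl fun i _ => ?_
  simp only [map_smul, smul_eq_mul]
  rw [mvfderiv_fun_mul hf (hV i)]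
  simp only [_root_.add_apply, _root_.smul_apply, smul_eq_mul]
  module

theorem covAlong_sum (hι : MDifferentiableAt (𝓡 m) (𝓡 d) ι p) {κ : Type*} (s : Finset κ)
    {V : κ → Π p : M, TangentSpace (𝓡 d) (ι p)} (hV : ∀ i ∈ s, DiffAlongAt m ι (V i) p)
    (v : TangentSpace (𝓡 m) p) :
    covAlong cov ι (fun q => ∑ i ∈ s, V i q) p v = ∑ i ∈ s, covAlong cov ι (V i) p v := by
  classical
  induction s using Finset.induction_on with
  | empty => simpa using covAlong_zero cov v
  | insert a s ha ih =>
    simp only [Finset.sum_insert ha]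
    rw [covAlong_add cov hι (hV a (by simp))
      (DiffAlongAt.sum hι s fun i hi => hV i (by simp [hi])), ih fun i hi => hV i (by simp [hi])]

theorem cov_sum {κ : Type*} (s : Finset κ) {W : κ → Π x : N, TangentSpace (𝓡 d) x} {x : N}
    (hW : ∀ i ∈ s, MDifferentiableAt (𝓡 d) (𝓡 d).tangent
      (fun y => (⟨y, W i y⟩ : TangentBundle (𝓡 d) N)) x) :
    cov (fun y => ∑ i ∈ s, W i y) x = ∑ i ∈ s, cov (W i) x := by
  classical
  induction s using Finset.induction_on with
  | empty =>
    simp only [Finset.sum_empty]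
    exact cov.isCovariantDerivativeOnUniv.zero
  | insert a s ha ih =>
    have hs : DiffAlongAt d (id : N → N) (fun y => ∑ i ∈ s, W i y) x :=
      DiffAlongAt.sum mdifferentiableAt_id s fun i hi => hW i (by simp [hi])
    rw [Finset.sum_insert ha, ← ih fun i hi => hW i (by simp [hi]),
      ← cov.isCovariantDerivativeOnUniv.add (hW a (by simp)) hs]
    simp only [Finset.sum_insert ha]
    rfl

/-- Consistency with the ambient connection: expand `W` in the chart frame near `ι p`, use the
Leibniz rule on `N`, and differentiate the coefficients by the chain rule. -/
theorem covAlong_comp (hι : MDifferentiableAt (𝓡 m) (𝓡 d) ι p)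
    {W : Π x : N, TangentSpace (𝓡 d) x}
    (hW : MDifferentiableAt (𝓡 d) (𝓡 d).tangent (fun y => (⟨y, W y⟩ : TangentBundle (𝓡 d) N))
      (ι p)) (v : TangentSpace (𝓡 m) p) :
    covAlong cov ι (fun q => W (ι q)) p v = cov W (ι p) (mfderiv (𝓡 m) (𝓡 d) ι p v) := by
  have hc := mdifferentiableAt_chartCoeff hW
  have hterm : ∀ i, DiffAlongAt d (id : N → N)
      (fun y => chartCoeff (ι p) i y (W y) • chartFrame (ι p) i y) (ι p) := fun i =>
    DiffAlongAt.smul mdifferentiableAt_id (hc i) (mdifferentiableAt_chartFrame _ i)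
  have hsum : ∀ᶠ y in 𝓝 (ι p),
      W y = ∑ i, chartCoeff (ι p) i y (W y) • chartFrame (ι p) i y := by
    filter_upwards [chart_baseSet_mem_nhds (d := d) (ι p)] with y hy
    exact sum_chartCoeff_smul_chartFrame hy (W y)
  rw [cov.isCovariantDerivativeOnUniv.congr_of_eventuallyEq hW
    (DiffAlongAt.sum (ι := (id : N → N)) mdifferentiableAt_id _ fun i _ => hterm i)
    Filter.univ_mem hsum, cov_sum cov _ fun i _ => hterm i, covAlong_eq,
    _root_.sum_apply]
  refine Finset.sum_congr rfl fun i _ => ?_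
  have h1 := cov.isCovariantDerivativeOnUniv.leibniz (mdifferentiableAt_chartFrame (ι p) i) (hc i)
  have h2 := mvfderiv_comp_apply (I' := 𝓡 m) p (hc i) hι v
  have h3 : cov (fun y => chartCoeff (ι p) i y (W y) • chartFrame (ι p) i y) (ι p)
    = _ := h1
  rw [h3, _root_.add_apply, _root_.smul_apply,
    ContinuousLinearMap.smulRight_apply, ← h2, add_comm]
  rfl

end AlongCalculus

/-! ### The tensor `∇̄φ` and the product rule for `φ` along a map. -/

section NablaPhi

variable {d m : ℕ} {N : Type*} [TopologicalSpace N] [ChartedSpace (EuclideanSpace ℝ (Fin d)) N]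
  [IsManifold (𝓡 d) ∞ N]
  {M : Type*} [TopologicalSpace M] [ChartedSpace (EuclideanSpace ℝ (Fin m)) M]
  {g : SemiRiemannianMetric d N} (C : AlmostContactMetric g)
  (cov : CovariantDerivative (𝓡 d) (EuclideanSpace ℝ (Fin d)) (TangentSpace (𝓡 d) : N → Type _))

theorem AlmostContactMetric.diffAlongAt_phi {ι : M → N} {p : M}
    (hι : MDifferentiableAt (𝓡 m) (𝓡 d) ι p) {V : Π p : M, TangentSpace (𝓡 d) (ι p)}
    (hV : DiffAlongAt m ι V p) : DiffAlongAt m ι (fun q => C.phi (ι q) (V q)) p :=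
  MDifferentiableAt.clm_bundle_apply (F₁ := EuclideanSpace ℝ (Fin d))
    (F₂ := EuclideanSpace ℝ (Fin d))
    (E₁ := (TangentSpace (𝓡 d) : N → Type _)) (E₂ := (TangentSpace (𝓡 d) : N → Type _))
    (((C.phi_smooth (ι p)).mdifferentiableAt (by simp)).comp p hι) hV

/-- For `fW` both terms produce the same `df(u) φW`, and the two cancel. -/
theorem AlmostContactMetric.tensorialAt_nablaPhi (x : N) (u : TangentSpace (𝓡 d) x) :
    TensorialAt (𝓡 d) (EuclideanSpace ℝ (Fin d))
      (fun W : Π x : N, TangentSpace (𝓡 d) x =>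
        cov (fun y => C.phi y (W y)) x u - C.phi x (cov W x u)) x where
  smul {f W} hf hW := by
    have hφ := C.diffAlongAt_phi (ι := (id : N → N)) mdifferentiableAt_id hW
    have h1 := cov.isCovariantDerivativeOnUniv.leibniz hφ hf
    have h2 := cov.isCovariantDerivativeOnUniv.leibniz hW hf
    have h3 : (fun y => C.phi y ((f • W) y)) = f • fun y => C.phi y (W y) := by
      funext y
      simp
    rw [h3, h2]
    erw [h1]
    simp only [_root_.add_apply, _root_.smul_apply, ContinuousLinearMap.smulRight_apply, map_add,
      map_smul, id]
    module
  add {W W'} hW hW' := by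
    have h1 := cov.isCovariantDerivativeOnUniv.add
      (C.diffAlongAt_phi (ι := (id : N → N)) mdifferentiableAt_id hW)
      (C.diffAlongAt_phi (ι := (id : N → N)) mdifferentiableAt_id hW')
    have h2 := cov.isCovariantDerivativeOnUniv.add hW hW'
    have h3 : (fun y => C.phi y ((W + W') y))
        = (fun y => C.phi y (W y)) + fun y => C.phi y (W' y) := by
      funext y
      simp
    rw [h3, h2]
    erw [h1]
    simp only [_root_.add_apply, map_add, id]
    module

/-- The tensor field `(∇_u φ) w`. -/
def AlmostContactMetric.nablaPhi (x : N) (u : TangentSpace (𝓡 d) x) :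
    TangentSpace (𝓡 d) x →L[ℝ] TangentSpace (𝓡 d) x :=
  TensorialAt.mkHom _ x (C.tensorialAt_nablaPhi cov x u)

theorem AlmostContactMetric.nablaPhi_apply {x : N} (u : TangentSpace (𝓡 d) x)
    {W : Π x : N, TangentSpace (𝓡 d) x}
    (hW : MDifferentiableAt (𝓡 d) (𝓡 d).tangent (fun y => (⟨y, W y⟩ : TangentBundle (𝓡 d) N)) x) :
    C.nablaPhi cov x u (W x) = cov (fun y => C.phi y (W y)) x u - C.phi x (cov W x u) :=
  TensorialAt.mkHom_apply (C.tensorialAt_nablaPhi cov x u) hW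

/-- The condition on fields becomes one on vectors by extending `u` and `w` to fields smooth at `x`.
It then applies to `dι X` and `dι Y` without extending them off `M`. -/
theorem IsNearlySasakian.nablaPhi_add {C : AlmostContactMetric g} {cov} {μ : N → ℝ}
    (hμ : IsNearlySasakian C cov μ) (x : N) (u w : TangentSpace (𝓡 d) x) :
    C.nablaPhi cov x u w + C.nablaPhi cov x w u
      = μ x • ((2 * g.val x u w) • C.xi x - C.eta x w • u - C.eta x u • w) := by
  have hs : ∀ v : TangentSpace (𝓡 d) x,
      SmoothFieldAt (FiberBundle.extend (EuclideanSpace ℝ (Fin d)) v) x := fun v =>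
    FiberBundle.contMDiffAt_extend (𝓡 d) (EuclideanSpace ℝ (Fin d)) v
  have hd := fun v => (hs v).mdifferentiableAt (by simp)
  have h := hμ x _ _ (hs u) (hs w)
  rw [← C.nablaPhi_apply cov _ (hd w), ← C.nablaPhi_apply cov _ (hd u)] at h
  simpa using h

/-- Write `V` in the chart frame. Derivatives of the coefficients pass through `φ` by linearity; the
frame fields live on `N`, where the rule defines `nablaPhi`, which is linear in the vector. -/
theorem AlmostContactMetric.covAlong_phi {ι : M → N} {p : M}
    (hι : MDifferentiableAt (𝓡 m) (𝓡 d) ι p) {V : Π p : M, TangentSpace (𝓡 d) (ι p)}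
    (hV : DiffAlongAt m ι V p) (v : TangentSpace (𝓡 m) p) :
    covAlong cov ι (fun q => C.phi (ι q) (V q)) p v
      = C.phi (ι p) (covAlong cov ι V p v)
        + C.nablaPhi cov (ι p) (mfderiv (𝓡 m) (𝓡 d) ι p v) (V p) := by
  have hc := (diffAlongAt_iff hι).1 hV
  have he := fun i => mdifferentiableAt_chartFrame (d := d) (ι p) i
  have hφe : ∀ i, MDifferentiableAt (𝓡 d) (𝓡 d).tangent
      (fun y => (⟨y, C.phi y (chartFrame (ι p) i y)⟩ : TangentBundle (𝓡 d) N)) (ι p) := fun i =>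
    C.diffAlongAt_phi (ι := (id : N → N)) mdifferentiableAt_id (he i)
  have hloc : ∀ᶠ q in 𝓝 p, C.phi (ι q) (V q)
      = ∑ i, chartCoeff (ι p) i (ι q) (V q) • C.phi (ι q) (chartFrame (ι p) i (ι q)) := by
    filter_upwards [hι.continuousAt.preimage_mem_nhds (chart_baseSet_mem_nhds (d := d) (ι p))]
      with q hq
    conv_lhs => rw [sum_chartCoeff_smul_chartFrame hq (V q)]
    simp only [map_sum, map_smul]
  have hV' := sum_chartCoeff_smul_chartFrame
    (mem_of_mem_nhds (chart_baseSet_mem_nhds (d := d) (ι p))) (V p)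
  rw [covAlong_congr cov hloc, covAlong_sum cov hι]
  · conv_rhs => rw [hV', map_sum]
    simp only [covAlong_eq cov V, map_sum, ← Finset.sum_add_distrib]
    refine Finset.sum_congr rfl fun i _ => ?_
    rw [covAlong_smul cov hι (hc i) (DiffAlongAt.comp hι (hφe i)),
      covAlong_comp cov hι (hφe i), map_smul, C.nablaPhi_apply cov _ (he i)]
    simp only [map_add, map_smul]
    module
  · exact fun i _ => DiffAlongAt.smul hι (hc i) (DiffAlongAt.comp hι (hφe i))

end NablaPhi

/-! ### Differentiability of projections onto subbundles. -/

section Subbundles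

variable {d m : ℕ} {N : Type*} [TopologicalSpace N] [ChartedSpace (EuclideanSpace ℝ (Fin d)) N]
  [IsManifold (𝓡 d) ∞ N]
  {M : Type*} [TopologicalSpace M] [ChartedSpace (EuclideanSpace ℝ (Fin m)) M]
  {ι : M → N} {p : M}

/-- The coefficients of a differentiable field with respect to a differentiable frame are
differentiable. -/
theorem DiffAlongAt.exists_coeff {κ : Type} [Fintype κ]
    {s : κ → Π p : M, TangentSpace (𝓡 d) (ι p)} (hs : ∀ j, DiffAlongAt m ι (s j) p)
    (hli : ∀ᶠ q in 𝓝 p, LinearIndependent ℝ (fun j => s j q))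
    (hsp : ∀ᶠ q in 𝓝 p, ⊤ ≤ Submodule.span ℝ (Set.range fun j => s j q))
    {V : Π p : M, TangentSpace (𝓡 d) (ι p)} (hV : DiffAlongAt m ι V p) :
    ∃ c : κ → M → ℝ, (∀ j, MDifferentiableAt (𝓡 m) 𝓘(ℝ, ℝ) (c j) p) ∧
      ∀ᶠ q in 𝓝 p, V q = ∑ j, c j q • s j q := by
  have hι : MDifferentiableAt (𝓡 m) (𝓡 d) ι p := ((mdifferentiableAt_totalSpace _ _).1 hV).1
  let e := trivializationAt (EuclideanSpace ℝ (Fin d)) (TangentSpace (𝓡 d) : N → Type _) (ι p)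
  let Ψ : Π q : M, TangentSpace (𝓡 d) (ι q) →L[ℝ] EuclideanSpace ℝ (Fin d) :=
    fun q => e.continuousLinearMapAt ℝ (ι q)
  have hbase : ∀ᶠ q in 𝓝 p, ι q ∈ e.baseSet :=
    hι.continuousAt.preimage_mem_nhds (chart_baseSet_mem_nhds (d := d) (ι p))
  have hΨe : ∀ q (hq : ι q ∈ e.baseSet),
      ⇑(e.continuousLinearEquivAt ℝ (ι q) hq) = Ψ q := fun q hq =>
    e.coe_continuousLinearEquivAt_eq hq
  have hΨ : ∀ {W : Π p : M, TangentSpace (𝓡 d) (ι p)}, DiffAlongAt m ι W p →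
      MDifferentiableAt (𝓡 m) 𝓘(ℝ, EuclideanSpace ℝ (Fin d)) (fun q => Ψ q (W q)) p := by
    intro W hW
    refine ((mdifferentiableAt_totalSpace _ _).1 hW).2.congr_of_eventuallyEq ?_
    filter_upwards [hbase] with q hq
    rw [← hΨe q hq]
    rfl
  -- `A q` is the matrix of the frame `s` read in the chart; the coefficients of `V` are `A⁻¹`
  -- applied to the chart coordinates of `V`.
  let A : M → (κ → ℝ) →L[ℝ] EuclideanSpace ℝ (Fin d) := fun q =>
    ∑ j, (ContinuousLinearMap.proj (R := ℝ) (φ := fun _ : κ => ℝ) j).smulRight (Ψ q (s j q))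
  have hA : ∀ q (c : κ → ℝ), A q c = Ψ q (∑ j, c j • s j q) := by
    intro q c
    simp [A, map_sum]
  have hAd : MDifferentiableAt (𝓡 m) 𝓘(ℝ, (κ → ℝ) →L[ℝ] EuclideanSpace ℝ (Fin d)) A p := by
    have : A = ∑ j, fun q => ContinuousLinearMap.smulRightL ℝ (κ → ℝ) (EuclideanSpace ℝ (Fin d))
        (ContinuousLinearMap.proj (R := ℝ) (φ := fun _ : κ => ℝ) j) (Ψ q (s j q)) := by
      funext q
      simp only [A, Finset.sum_apply]
      rfl
    rw [this]
    exact MDifferentiableAt.sum fun j _ =>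
      (ContinuousLinearMap.mdifferentiableAt _).comp p (hΨ (hs j))
  have hinv : ∀ᶠ q in 𝓝 p, ∃ f : (κ → ℝ) ≃L[ℝ] EuclideanSpace ℝ (Fin d),
      (f : (κ → ℝ) →L[ℝ] EuclideanSpace ℝ (Fin d)) = A q := by
    filter_upwards [hbase, hli, hsp] with q hq h1 h2
    refine ⟨((Module.Basis.mk h1 h2).equivFun.symm.trans
      (e.continuousLinearEquivAt ℝ (ι q) hq).toLinearEquiv).toContinuousLinearEquiv, ?_⟩
    ext1 c
    rw [hA]
    rw [← hΨe q hq]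
    change e.continuousLinearEquivAt ℝ (ι q) hq ((Module.Basis.mk h1 h2).equivFun.symm c) = _
    simp only [Module.Basis.equivFun_symm_apply, Module.Basis.mk_apply]
  obtain ⟨f, hf⟩ := hinv.self_of_nhds
  -- Inversion is smooth at an invertible map. The default value of `inverse` elsewhere is harmless,
  -- since `A q` is invertible for `q` near `p`.
  have hc : MDifferentiableAt (𝓡 m) 𝓘(ℝ, κ → ℝ)
      (fun q => ContinuousLinearMap.inverse (A q) (Ψ q (V q))) p := by
    have h1 : MDifferentiableAt (𝓡 m) 𝓘(ℝ, EuclideanSpace ℝ (Fin d) →L[ℝ] (κ → ℝ))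
        (fun q => ContinuousLinearMap.inverse (A q)) p := by
      have h2 : DifferentiableAt ℝ ContinuousLinearMap.inverse (A p) := by
        rw [← hf]
        exact (contDiffAt_map_inverse (n := 1) f).differentiableAt one_ne_zero
      exact h2.mdifferentiableAt.comp p hAd
    exact h1.clm_apply (hΨ hV)
  refine ⟨fun j q => ContinuousLinearMap.inverse (A q) (Ψ q (V q)) j, fun j => ?_, ?_⟩
  · exact (ContinuousLinearMap.proj (R := ℝ) (φ := fun _ : κ => ℝ) j).mdifferentiableAt.comp p hc
  · filter_upwards [hbase, hinv] with q hq ⟨f, hf⟩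
    have h1 : A q (ContinuousLinearMap.inverse (A q) (Ψ q (V q))) = Ψ q (V q) := by
      rw [← hf, ContinuousLinearMap.inverse_equiv]
      simp
    rw [hA] at h1
    have h2 : Function.Injective (Ψ q) := by
      rw [← hΨe q hq]
      exact (e.continuousLinearEquivAt ℝ (ι q) hq).injective
    exact (h2 h1).symm

theorem IsSubbundleAlong.sup {k l : ℕ} {F G : Π p : M, Submodule ℝ (TangentSpace (𝓡 d) (ι p))}
    (hF : IsSubbundleAlong m ι k F) (hG : IsSubbundleAlong m ι l G)
    (h : ∀ p, F p ⊓ G p = ⊥) : IsSubbundleAlong m ι (k + l) fun p => F p ⊔ G p := by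
  intro p₀
  obtain ⟨U, hU, hpU, s, hs, hs'⟩ := hF p₀
  obtain ⟨U', hU', hpU', t, ht, ht'⟩ := hG p₀
  refine ⟨U ∩ U', hU.inter hU', ⟨hpU, hpU'⟩, fun i => Sum.elim s t (finSumFinEquiv.symm i), ?_, ?_⟩
  · intro i
    beta_reduce
    rcases finSumFinEquiv.symm i with j | j
    · exact (hs j).mono Set.inter_subset_left
    · exact (ht j).mono Set.inter_subset_right
  · rintro p ⟨hp, hp'⟩
    have he : (fun i => Sum.elim s t (finSumFinEquiv.symm i) p)
        = Sum.elim (fun i => s i p) (fun j => t j p) ∘ (finSumFinEquiv (m := k) (n := l)).symm := by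
      funext i
      simp only [Function.comp]
      rcases finSumFinEquiv.symm i with j | j <;> rfl
    rw [he]
    constructor
    · refine (LinearIndependent.sum_type (hs' p hp).1 (ht' p hp').1 ?_).comp _
        (Equiv.injective _)
      rw [(hs' p hp).2, (ht' p hp').2]
      exact disjoint_iff.2 (h p)
    · rw [Set.range_comp, Equiv.range_eq_univ, Set.image_univ, Set.Sum.elim_range,
        Submodule.span_union, (hs' p hp).2, (ht' p hp').2]

/-- Local frames of `F` and `G` together form a frame of the ambient tangent bundle along `ι`; the
projection keeps the `F`-coefficients, which `DiffAlongAt.exists_coeff` makes differentiable. -/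
theorem IsSubbundleAlong.diffAlongAt_projection {k l : ℕ}
    {F G : Π p : M, Submodule ℝ (TangentSpace (𝓡 d) (ι p))}
    (hF : IsSubbundleAlong m ι k F) (hG : IsSubbundleAlong m ι l G)
    (h : ∀ p, IsCompl (F p) (G p))
    {V : Π p : M, TangentSpace (𝓡 d) (ι p)} (hV : DiffAlongAt m ι V p) :
    DiffAlongAt m ι (fun q => (F q).projection (G q) (h q) (V q)) p := by
  have hι : MDifferentiableAt (𝓡 m) (𝓡 d) ι p := ((mdifferentiableAt_totalSpace _ _).1 hV).1
  obtain ⟨U, hU, hpU, s, hs, hs'⟩ := hF p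
  obtain ⟨U', hU', hpU', t, ht, ht'⟩ := hG p
  have hsd : ∀ i, DiffAlongAt m ι (s i) p := fun i =>
    ((hs i).contMDiffAt (hU.mem_nhds hpU)).mdifferentiableAt (by simp)
  have htd : ∀ i, DiffAlongAt m ι (t i) p := fun i =>
    ((ht i).contMDiffAt (hU'.mem_nhds hpU')).mdifferentiableAt (by simp)
  have he : ∀ q, (fun i => Sum.elim s t i q) = Sum.elim (fun i => s i q) (fun j => t j q) := by
    intro q
    funext i
    rcases i with i | i <;> rfl
  have hmem : ∀ᶠ q in 𝓝 p, q ∈ U ∧ q ∈ U' :=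
    (hU.eventually_mem hpU).and (hU'.eventually_mem hpU')
  obtain ⟨c, hc, hcV⟩ := DiffAlongAt.exists_coeff (m := m) (s := Sum.elim s t) (p := p)
    (by rintro (i | i); exacts [hsd i, htd i])
    (by
      filter_upwards [hmem] with q ⟨hq, hq'⟩
      rw [he]
      refine LinearIndependent.sum_type (hs' q hq).1 (ht' q hq').1 ?_
      rw [(hs' q hq).2, (ht' q hq').2]
      exact (h q).disjoint)
    (by
      filter_upwards [hmem] with q ⟨hq, hq'⟩
      rw [he, Set.Sum.elim_range, Submodule.span_union, (hs' q hq).2, (ht' q hq').2,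
        (h q).sup_eq_top]) hV
  refine (DiffAlongAt.sum hι Finset.univ fun i _ =>
    DiffAlongAt.smul hι (hc (Sum.inl i)) (hsd i)).congr ?_
  filter_upwards [hcV, hmem] with q hq ⟨hqU, hqU'⟩
  have h1 : ∑ i, c (Sum.inl i) q • s i q ∈ F q := by
    rw [← (hs' q hqU).2]
    exact Submodule.sum_mem _ fun i _ => Submodule.smul_mem _ _ (Submodule.subset_span ⟨i, rfl⟩)
  have h2 : ∑ i, c (Sum.inr i) q • t i q ∈ G q := by
    rw [← (ht' q hqU').2]
    exact Submodule.sum_mem _ fun i _ => Submodule.smul_mem _ _ (Submodule.subset_span ⟨i, rfl⟩)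
  rw [hq, Fintype.sum_sum_type, map_add]
  simp only [Sum.elim_inl, Sum.elim_inr]
  rw [Submodule.projection_apply_of_mem_left _ h1, (Submodule.projection_apply_eq_zero_iff _).2 h2,
    add_zero]

end Subbundles

/-! ### Global smooth fields and functions with prescribed behaviour at a point. -/

section Extension

variable {m : ℕ} {M : Type*} [TopologicalSpace M] [T2Space M]
  [ChartedSpace (EuclideanSpace ℝ (Fin m)) M] [IsManifold (𝓡 m) ∞ M]

/-- `IsNearlyParallel` quantifies over global fields, so a local extension of `v` is cut off by a
bump function. -/
theorem exists_smoothField_apply_eq (p : M) (v : TangentSpace (𝓡 m) p) :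
    ∃ X : Π p : M, TangentSpace (𝓡 m) p, SmoothField X ∧ X p = v := by
  obtain ⟨s, hs, hsm⟩ := FiberBundle.exists_contMDiffOn_extend (k := ∞) (𝓡 m)
    (EuclideanSpace ℝ (Fin m)) v
  obtain ⟨u, hus, hu, hpu⟩ := mem_nhds_iff.1 hs
  obtain ⟨ψ, -, hψ⟩ := (SmoothBumpFunction.nhds_basis_tsupport (I := 𝓡 m) p).mem_iff.1
    (hu.mem_nhds hpu)
  refine ⟨(ψ : M → ℝ) • FiberBundle.extend (EuclideanSpace ℝ (Fin m)) v,
    ContMDiffOn.smul_section_of_tsupport ψ.contMDiff.contMDiffOn hu hψ (hsm.mono hus), ?_⟩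
  simp

/-- Take a chart coordinate in which `v` has a nonzero component, multiplied by a bump function that
equals one near `p`. -/
theorem exists_contMDiff_mvfderiv_ne_zero {p : M} {v : TangentSpace (𝓡 m) p} (hv : v ≠ 0) :
    ∃ f : M → ℝ, ContMDiff (𝓡 m) 𝓘(ℝ, ℝ) ∞ f ∧ mvfderiv (𝓡 m) f p v ≠ 0 := by
  have hw : mfderiv (𝓡 m) 𝓘(ℝ, EuclideanSpace ℝ (Fin m)) (extChartAt (𝓡 m) p) p v ≠ 0 := by
    intro h
    exact hv ((isInvertible_mfderiv_extChartAt (mem_extChartAt_source p)).injective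
      (h.trans (map_zero _).symm))
  let w : EuclideanSpace ℝ (Fin m) :=
    mfderiv (𝓡 m) 𝓘(ℝ, EuclideanSpace ℝ (Fin m)) (extChartAt (𝓡 m) p) p v
  obtain ⟨i, hi⟩ : ∃ i, w i ≠ 0 := by
    by_contra! h
    exact hw (PiLp.ext h)
  let ℓ : EuclideanSpace ℝ (Fin m) →L[ℝ] ℝ := EuclideanSpace.proj i
  let ψ : SmoothBumpFunction (𝓡 m) p := Classical.arbitrary _
  have hℓ : MDifferentiableAt 𝓘(ℝ, EuclideanSpace ℝ (Fin m)) 𝓘(ℝ, ℝ) ℓ (extChartAt (𝓡 m) p p) :=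
    ℓ.mdifferentiableAt
  refine ⟨fun q => ψ q • ℓ (extChartAt (𝓡 m) p q), ?_, ?_⟩
  · refine ψ.contMDiff_smul ?_
    exact ℓ.contMDiff.comp_contMDiffOn contMDiffOn_extChartAt
  · rw [mvfderiv_congr (f' := ℓ ∘ extChartAt (𝓡 m) p)
      (ψ.eventuallyEq_one.mono fun q hq => by simp [hq]),
      mvfderiv_comp_apply p hℓ (mdifferentiableAt_extChartAt (mem_chart_source _ p))]
    rw [mvfderiv, ℓ.mfderiv_eq]
    exact hi

end Extension

/-! ### Gauss–Weingarten calculus on the lightlike submanifold. -/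

section Lightlike

variable {d m : ℕ} {N : Type*} [TopologicalSpace N] [ChartedSpace (EuclideanSpace ℝ (Fin d)) N]
  [IsManifold (𝓡 d) ∞ N]
  {M : Type*} [TopologicalSpace M] [ChartedSpace (EuclideanSpace ℝ (Fin m)) M]
  {g : SemiRiemannianMetric d N}
  (cov : CovariantDerivative (𝓡 d) (EuclideanSpace ℝ (Fin d)) (TangentSpace (𝓡 d) : N → Type _))
  {C : AlmostContactMetric g}

theorem covAlong_smul_right {ι : M → N} (V : Π p : M, TangentSpace (𝓡 d) (ι p)) {p : M} (a : ℝ)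
    (v : TangentSpace (𝓡 m) p) : covAlong cov ι V p (a • v) = a • covAlong cov ι V p v := by
  simp only [covAlong_eq, map_smul, Finset.smul_sum]
  refine Finset.sum_congr rfl fun i _ => ?_
  rw [smul_eq_mul]
  module

namespace LightlikeSubmanifold

variable (L : LightlikeSubmanifold g m M)

theorem mdifferentiableAt_ι (p : M) : MDifferentiableAt (𝓡 m) (𝓡 d) L.ι p :=
  (L.ι_smooth p).mdifferentiableAt (by simp)

theorem diffAlongAt_pushField [IsManifold (𝓡 m) ∞ M] {X : Π p : M, TangentSpace (𝓡 m) p}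
    {p : M} (hX : SmoothFieldAt X p) : DiffAlongAt m L.ι (pushField (d := d) L.ι X) p := by
  have h1 : ContMDiff (𝓡 m).tangent (𝓡 d).tangent ∞ (tangentMap (𝓡 m) (𝓡 d) L.ι) :=
    L.ι_smooth.contMDiff_tangentMap (by simp)
  exact ((h1 _).comp p hX).mdifferentiableAt (by simp)

theorem tan_subbundle : ∃ k, IsSubbundleAlong m L.ι k L.tan := by
  obtain ⟨k, hk⟩ := L.screen_subbundle
  refine ⟨L.r + k, ?_⟩
  convert! L.rad_subbundle.sup hk L.rad_inf_screen with p
  exact (L.rad_sup_screen p).symm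

/-- `ltr(TM)` is orthogonal to `S(TM^⊥)`, so a common vector lies in the radical of the
nondegenerate `S(TM^⊥)`. -/
theorem ltr_inf_screenTr (p : M) : L.ltr p ⊓ L.screenTr p = ⊥ := by
  rw [eq_bot_iff, ← L.screenTr_nondegenerate p]
  refine le_inf inf_le_right fun x hx => ?_
  have h : x ∈ g.perp (L.screen p ⊔ L.screenTr p) := by
    rw [← L.rad_sup_ltr p]
    exact Submodule.mem_sup_right hx.1
  exact fun t ht => h t (Submodule.mem_sup_right ht)

theorem tr_subbundle : ∃ k, IsSubbundleAlong m L.ι k L.tr := by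
  obtain ⟨k, hk⟩ := L.screenTr_subbundle
  exact ⟨L.r + k, L.ltr_subbundle.sup hk L.ltr_inf_screenTr⟩

theorem diffAlongAt_tanProj {V : Π p : M, TangentSpace (𝓡 d) (L.ι p)} {p : M}
    (hV : DiffAlongAt m L.ι V p) : DiffAlongAt m L.ι (fun q => L.tanProj q (V q)) p := by
  obtain ⟨k, hk⟩ := L.tan_subbundle
  obtain ⟨l, hl⟩ := L.tr_subbundle
  exact hk.diffAlongAt_projection hl L.isCompl_tan_tr hV

theorem diffAlongAt_trProj {V : Π p : M, TangentSpace (𝓡 d) (L.ι p)} {p : M}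
    (hV : DiffAlongAt m L.ι V p) : DiffAlongAt m L.ι (fun q => L.trProj q (V q)) p := by
  obtain ⟨k, hk⟩ := L.tan_subbundle
  obtain ⟨l, hl⟩ := L.tr_subbundle
  exact hl.diffAlongAt_projection hk (fun p => (L.isCompl_tan_tr p).symm) hV

theorem tanProj_add_trProj (p : M) (v : TangentSpace (𝓡 d) (L.ι p)) :
    L.tanProj p v + L.trProj p v = v :=
  Submodule.projection_add_projection_eq_self (L.isCompl_tan_tr p) v

theorem tanProj_of_mem {p : M} {v : TangentSpace (𝓡 d) (L.ι p)} (hv : v ∈ L.tan p) :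
    L.tanProj p v = v :=
  Submodule.projection_apply_of_mem_left _ hv

theorem trProj_mem (p : M) (v : TangentSpace (𝓡 d) (L.ι p)) : L.trProj p v ∈ L.tr p :=
  Submodule.projection_apply_mem (L.isCompl_tan_tr p).symm v

theorem pushField_mem_tan (X : Π p : M, TangentSpace (𝓡 m) p) (p : M) :
    pushField L.ι X p ∈ L.tan p :=
  ⟨X p, rfl⟩

theorem rad_ne_bot (p : M) : L.rad p ≠ ⊥ := by
  intro h
  obtain ⟨U, -, hp, s, -, hs⟩ := L.rad_subbundle p
  obtain ⟨h1, h2⟩ := hs p hp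
  have hmem : s ⟨0, L.r_pos⟩ p ∈ L.rad p := by
    change _ ∈ radAlong g m L.ι p
    rw [← h2]
    exact Submodule.subset_span ⟨_, rfl⟩
  rw [h, Submodule.mem_bot] at hmem
  exact h1.ne_zero _ hmem

/-- The vector `-A_{ϕ₁X} Y - A_{φY} X + ∇_Y φ₁X` is the tangential part of
`∇̄_X φY + ∇̄_Y φX`. -/
theorem shape_add_indConn_eq [IsManifold (𝓡 m) ∞ M] {X Y : Π p : M, TangentSpace (𝓡 m) p} {p : M}
    (hX : SmoothFieldAt X p) :
    -L.shape cov (L.phiTr C X) Y p - L.shape cov (L.phiField C (pushField L.ι Y)) X p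
        + L.indConn cov Y (L.phiTan C X) p
      = L.tanProj p (covAlong cov L.ι (fun q => C.phi (L.ι q) (pushField L.ι Y q)) p (X p)
          + covAlong cov L.ι (fun q => C.phi (L.ι q) (pushField L.ι X q)) p (Y p)) := by
  have hι := L.mdifferentiableAt_ι p
  have hφ := C.diffAlongAt_phi hι (L.diffAlongAt_pushField hX)
  -- Additivity needs `φ₁X` and `ϕ₁X` to be differentiable separately; this is where smoothness of
  -- the projections enters.
  have h := covAlong_add cov hι (L.diffAlongAt_tanProj hφ) (L.diffAlongAt_trProj hφ) (Y p)
  simp only [tanProj_add_trProj] at h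
  rw [h, map_add, map_add]
  simp only [shape, indConn]
  change - -L.tanProj p (covAlong cov L.ι
      (fun q => L.trProj q (C.phi (L.ι q) (pushField L.ι X q))) p (Y p))
    - -L.tanProj p (covAlong cov L.ι (fun q => C.phi (L.ι q) (pushField L.ι Y q)) p (X p))
    + L.tanProj p (covAlong cov L.ι
      (fun q => L.tanProj q (C.phi (L.ι q) (pushField L.ι X q))) p (Y p)) = _
  abel

/-- The product rule is applied to each summand; the two `∇̄φ` terms are the symmetrization that the
nearly Sasakian identity evaluates. -/
theorem covAlong_phi_add [IsManifold (𝓡 m) ∞ M] {cov} {μ : N → ℝ} (hμ : IsNearlySasakian C cov μ)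
    {X Y : Π p : M, TangentSpace (𝓡 m) p} {p : M} (hX : SmoothFieldAt X p)
    (hY : SmoothFieldAt Y p) :
    covAlong cov L.ι (fun q => C.phi (L.ι q) (pushField L.ι Y q)) p (X p)
        + covAlong cov L.ι (fun q => C.phi (L.ι q) (pushField L.ι X q)) p (Y p)
      = C.phi (L.ι p) (covAlong cov L.ι (pushField L.ι Y) p (X p)
          + covAlong cov L.ι (pushField L.ι X) p (Y p))
        + μ (L.ι p) • ((2 * g.val (L.ι p) (pushField L.ι X p) (pushField L.ι Y p)) • C.xi (L.ι p)
          - C.eta (L.ι p) (pushField L.ι Y p) • pushField L.ι X p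
          - C.eta (L.ι p) (pushField L.ι X p) • pushField L.ι Y p) := by
  have hι := L.mdifferentiableAt_ι p
  rw [C.covAlong_phi cov hι (L.diffAlongAt_pushField hX),
    C.covAlong_phi cov hι (L.diffAlongAt_pushField hY), ← hμ.nablaPhi_add, map_add]
  change _ + C.nablaPhi cov (L.ι p) (pushField L.ι X p) _
    + (_ + C.nablaPhi cov (L.ι p) (pushField L.ι Y p) _) = _
  abel

variable {L} {cov}

/-- The condition `∇_X Y + ∇_Y X ∈ Γ(F)` is not tensorial in `X`: by the Leibniz rule it gives
`Y(f) X ∈ Γ(F)` for all functions `f`, hence `Y = 0` unless `F = TM`. -/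
theorem IsNearlyParallel.eq_zero [T2Space M] [IsManifold (𝓡 m) ∞ M]
    {F : Π p : M, Submodule ℝ (TangentSpace (𝓡 d) (L.ι p))} (hF : L.IsNearlyParallel cov F)
    {Y : Π p : M, TangentSpace (𝓡 m) p} (hY : SmoothField Y)
    (hYF : ∀ p, pushField L.ι Y p ∈ F p) {p : M} (hne : ¬ L.tan p ≤ F p) : Y p = 0 := by
  by_contra hv
  obtain ⟨_, ⟨v, rfl⟩, hvF⟩ := Set.not_subset.1 hne
  obtain ⟨X, hX, hXp⟩ := exists_smoothField_apply_eq p v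
  obtain ⟨f, hf, hfY⟩ := exists_contMDiff_mvfderiv_ne_zero hv
  have hfX : SmoothField (f • X) := ContMDiff.smul_section hf hX
  have hι := L.mdifferentiableAt_ι p
  have hpush : pushField (d := d) L.ι (f • X) = fun q => f q • pushField (d := d) L.ι X q := by
    funext q
    exact map_smul (mfderiv (𝓡 m) (𝓡 d) L.ι q) (f q) (X q)
  have h1 := hF _ Y hfX hY hYF p
  have h2 := (F p).smul_mem (f p) (hF X Y hX hY hYF p)
  rw [hpush] at h1
  simp only [indConn] at h1 h2
  rw [covAlong_smul cov hι ((hf p).mdifferentiableAt (by simp)) (L.diffAlongAt_pushField (hX p))]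
    at h1
  have h3 : covAlong cov L.ι (pushField L.ι Y) p ((f • X) p)
    = f p • covAlong cov L.ι (pushField L.ι Y) p (X p) := covAlong_smul_right cov _ _ _
  rw [h3, map_add, map_smul, map_smul, map_smul, L.tanProj_of_mem (L.pushField_mem_tan X p)] at h1
  -- The condition for `fX` minus `f p` times the condition for `X` leaves only the Leibniz term
  -- `Y(f) X`.
  have h4 := (F p).sub_mem h1 h2
  have h5 : mvfderiv (𝓡 m) f p (Y p) • pushField L.ι X p ∈ F p := by
    convert! h4 using 1
    rw [smul_add]
    abel
  refine hvF ?_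
  have h6 := ((F p).smul_mem_iff hfY).1 h5
  rwa [pushField, hXp] at h6

end LightlikeSubmanifold

/-! ### Linear algebra of `D`, `Dbar`, `tr(TM)` and `ξ`. -/

namespace QGCRStructure

variable {L : LightlikeSubmanifold g m M} (Q : QGCRStructure C L)

/-- `Rad TM` is nonzero because `r > 0`, and it lies in `D`, which meets `Dbar` trivially. -/
theorem not_tan_le_Dbar (p : M) : ¬ L.tan p ≤ Q.Dbar p := by
  intro h
  refine L.rad_ne_bot p (eq_bot_iff.2 ?_)
  rw [← Q.D_inf_Dbar p]
  exact le_inf (le_sup_left.trans le_sup_left) ((inf_le_left : L.rad p ≤ L.tan p).trans h)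

theorem DProj_eq_zero {p : M} {v : TangentSpace (𝓡 d) (L.ι p)} (hv : v ∈ Q.Dbar p ⊔ L.tr p) :
    Q.DProj p v = 0 :=
  (Submodule.projection_apply_eq_zero_iff (Q.isCompl_D p)).2 hv

/-- The discarded transversal part is in the kernel of `DProj`, so tangential projections can be
dropped. -/
theorem DProj_tanProj (p : M) (v : TangentSpace (𝓡 d) (L.ι p)) :
    Q.DProj p (L.tanProj p v) = Q.DProj p v := by
  conv_rhs => rw [← L.tanProj_add_trProj p v, map_add,
    Q.DProj_eq_zero (Submodule.mem_sup_right (L.trProj_mem p v)), add_zero]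

variable {Q}

theorem IsCoScreen.xi_mem_tr (hQ : Q.IsCoScreen) (p : M) : C.xi (L.ι p) ∈ L.tr p :=
  Submodule.mem_sup_right (hQ p)

/-- `ξ` is normal to `M`, and `η = g(ξ, ·)`. -/
theorem IsCoScreen.eta_eq_zero (hQ : Q.IsCoScreen) {p : M} {v : TangentSpace (𝓡 d) (L.ι p)}
    (hv : v ∈ L.tan p) : C.eta (L.ι p) v = 0 := by
  have h : C.xi (L.ι p) ∈ normalAlong g m L.ι p := by
    rw [← L.rad_sup_screenTr p]
    exact Submodule.mem_sup_right (hQ p)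
  rw [C.eta_eq, g.symm]
  exact h v hv

/-- Checked on each summand: `φ` sends `Dbar` into `tr(TM)`, sends `φ Dbar` back into `Dbar + ℝξ` by
the formula for `φ²`, preserves `𝒢`, and kills `ξ`. -/
theorem IsInvariantComplement.phi_mem {G : Π p : M, Submodule ℝ (TangentSpace (𝓡 d) (L.ι p))}
    (hG : Q.IsInvariantComplement G) {p : M} {v : TangentSpace (𝓡 d) (L.ι p)}
    (hv : v ∈ Q.Dbar p ⊔ L.tr p) : C.phi (L.ι p) v ∈ Q.Dbar p ⊔ L.tr p := by
  have h1 : L.phiMap C Q.Dbar p ≤ L.tr p := by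
    rw [← hG.sup_eq p]
    exact le_sup_left.trans le_sup_left
  have h2 : G p ≤ L.tr p := by
    rw [← hG.sup_eq p]
    exact le_sup_right.trans le_sup_left
  have hξ : C.xi (L.ι p) ∈ L.tr p := by
    rw [← hG.sup_eq p]
    exact Submodule.mem_sup_right (Submodule.mem_span_singleton_self _)
  suffices h : Q.Dbar p ⊔ L.tr p ≤ (Q.Dbar p ⊔ L.tr p).comap (C.phi (L.ι p)).toLinearMap from h hv
  rw [← hG.sup_eq p]
  refine sup_le ?_ (sup_le (sup_le ?_ ?_) ?_)
  · intro w hw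
    rw [hG.sup_eq p]
    exact Submodule.mem_sup_right (h1 ⟨w, hw, rfl⟩)
  · rintro _ ⟨w, hw, rfl⟩
    rw [hG.sup_eq p]
    change C.phi (L.ι p) (C.phi (L.ι p) w) ∈ Q.Dbar p ⊔ L.tr p
    rw [C.phi_phi]
    exact add_mem (neg_mem (Submodule.mem_sup_left hw))
      (Submodule.smul_mem _ _ (Submodule.mem_sup_right hξ))
  · intro w hw
    rw [hG.sup_eq p]
    refine Submodule.mem_sup_right (h2 ?_)
    rw [← hG.phi_eq p]
    exact ⟨w, hw, rfl⟩
  · rw [Submodule.span_singleton_le_iff_mem]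
    rw [hG.sup_eq p]
    change C.phi (L.ι p) (C.xi (L.ι p)) ∈ Q.Dbar p ⊔ L.tr p
    rw [C.phi_xi]
    exact zero_mem _

end QGCRStructure

end Lightlike

end

/-! ### The two claims. -/

theorem mainTheorem5
    {n m : ℕ}
    {N : Type*} [TopologicalSpace N] [T2Space N] [SecondCountableTopology N]
    [ChartedSpace (EuclideanSpace ℝ (Fin (2 * n + 1))) N] [IsManifold (𝓡 (2 * n + 1)) ∞ N]
    {M : Type*} [TopologicalSpace M] [T2Space M] [SecondCountableTopology M]
    [ChartedSpace (EuclideanSpace ℝ (Fin m)) M] [IsManifold (𝓡 m) ∞ M]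
    (g : SemiRiemannianMetric (2 * n + 1) N)
    (C : AlmostContactMetric g)
    (cov : CovariantDerivative (𝓡 (2 * n + 1)) (EuclideanSpace ℝ (Fin (2 * n + 1)))
      (TangentSpace (𝓡 (2 * n + 1)) : N → Type _))
    (hcov : IsLeviCivita g cov)
    (μ : N → ℝ)
    (hμ : IsNearlySasakian C cov μ)
    (L : LightlikeSubmanifold g m M)
    (Q : QGCRStructure C L)
    (hQ : Q.IsCoScreen) :
    (L.IsNearlyParallel cov Q.Dbar →
      ∀ X Y : Π p : M, TangentSpace (𝓡 m) p, SmoothField X → SmoothField Y →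
        (∀ p, pushField L.ι Y p ∈ Q.Dbar p) →
        ∀ p, Q.DProj p
          (-L.shape cov (L.phiTr C X) Y p - L.shape cov (L.phiField C (pushField L.ι Y)) X p
            + L.indConn cov Y (L.phiTan C X) p) = 0) ∧
    (∀ G : Π p : M, Submodule ℝ (TangentSpace (𝓡 (2 * n + 1)) (L.ι p)),
      Q.IsInvariantComplement G →
      ∀ X Y : Π p : M, TangentSpace (𝓡 m) p, SmoothField X → SmoothField Y →
        (∀ p, pushField L.ι Y p ∈ Q.Dbar p) →
        ∀ p, L.indConn cov X (pushField L.ι Y) p + L.indConn cov Y (pushField L.ι X) p ∈ Q.Dbar p →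
        Q.DProj p
          (-L.shape cov (L.phiTr C X) Y p - L.shape cov (L.phiField C (pushField L.ι Y)) X p
            + L.indConn cov Y (L.phiTan C X) p) = 0) := by
  refine ⟨fun hpar X Y _ hY hYD p => ?_, fun G hG X Y hX hY hYD p hp => ?_⟩
  · have hY0 : Y = fun _ => 0 := by
      funext q
      exact LightlikeSubmanifold.IsNearlyParallel.eq_zero hpar hY hYD (Q.not_tan_le_Dbar q)
    have hφ0 : L.phiField C (pushField L.ι Y) = fun q => (0 : TangentSpace _ (L.ι q)) := by
      funext q
      simp [LightlikeSubmanifold.phiField, pushField, hY0]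
    rw [hφ0]
    -- Two of the terms differentiate in the direction `Y = 0`; the third differentiates the zero
    -- field `φY`.
    simp only [LightlikeSubmanifold.shape, LightlikeSubmanifold.indConn, covAlong_zero, hY0,
      covAlong_zero_right, map_zero, neg_zero, sub_zero, add_zero]
  · rw [L.shape_add_indConn_eq cov (hX p), L.covAlong_phi_add hμ (hX p) (hY p), Q.DProj_tanProj,
      hQ.eta_eq_zero (L.pushField_mem_tan X p), hQ.eta_eq_zero (L.pushField_mem_tan Y p),
      zero_smul, zero_smul, sub_zero, sub_zero]
    refine Q.DProj_eq_zero (add_mem (hG.phi_mem ?_) (Submodule.smul_mem _ _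
      (Submodule.smul_mem _ _ (Submodule.mem_sup_right (hQ.xi_mem_tr p)))))
    -- Split `∇̄_X Y + ∇̄_Y X` at `p`: its tangential part is in `Dbar` by `hp`, and the rest is
    -- transversal.
    rw [← L.tanProj_add_trProj p (_ + _)]
    refine add_mem (Submodule.mem_sup_left ?_) (Submodule.mem_sup_right (L.trProj_mem p _))
    rw [map_add]
    exact hp
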